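/- **Corollary 4.3 (Model consistency of ADGD).** Let $R:\mathbb R^p\to\mathbb R\cup\{+\infty\}$ be proper, convex and lower semicontinuous, let $\alpha>0$, $R_\alpha:=R+\frac{\alpha}{2}\|\cdot\|^2$, let $X\in\mathbb R^{n\times p}$ be nonzero, $\gamma:=\alpha\|X\|^{-2}$, and let $y^\dagger\in\mathbb R^n$. For $y\in\mathbb R^n$ define * the *dual gradient descent* (DGD) iterates by $v^{(0)}=0$, $\;v^{(k+1)}=v^{(k)}+\gamma\big(X\,\mathrm{prox}_{\alpha^{-1}R}(-\alpha^{-1}X^\top v^{(k)})-y\big)$; * for $\theta>2$, the *accelerated dual gradient descent* (ADGD) iterates by $v^{(0)}=u^{(-1)}=0$ and, for $k=0,1,2,\dots$, $$u^{(k)}=v^{(k)}+\gamma\big(X\,\mathrm{prox}_{\alpha^{-1}R}(-\alpha^{-1}X^\top v^{(k)})-y\big),\qquad v^{(k+1)}=u^{(k)}+\tfrac{k-1}{k+\theta}\big(u^{(k)}-u^{(k-1)}\big),\qquad w^{(k)}=\mathrm{prox}_{\alpha^{-1}R}(-\alpha^{-1}X^\top u^{(k)}).$$ Suppose that 1. $w^\dagger$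 is the unique solution of $\min_w R_\alpha(w)$ subject to $Xw=y^\dagger$, and the DGD iterates for the exact data $y=y^\dagger$ converge to a point $v^\dagger$ that solves the dual problem $\min_v R_\alpha^*(-X^\top v)+\langle y^\dagger,v\rangle$; 2. $-X^\top v^\dagger\in\mathrm{ri}\big(\partial R_\alpha(w^\dagger)\big)$; 3. $R$ is partly smooth at $w^\dagger$ relative to a set $\mathcal M_{w^\dagger}\subset\mathbb R^p$. That is: $\partial R(w^\dagger)\neq\emptyset$; $\mathcal M_{w^\dagger}$ is a $C^2$ manifold around $w^\dagger$ and $R|_{\mathcal M_{w^\dagger}}$ is $C^2$ near $w^\dagger$; the tangent space of $\mathcal M_{w^\dagger}$ at $w^\dagger$ is the orthogonal complement of $\operatorname{span}\{a-b: a,b\in\partial R(w^\dagger)\}$; and $\partial R$ is continuous (inner and outer semicontinuous) along $\mathcal M_{w^\dagger}$ at all points of $\mathcal M_{w^\dagger}$ near $w^\dagger$. Let $c>0$ and, for $\delta>0$, put $k_\delta:=\lceil c\,\delta^{-1/2}\rceil$. Then there is $\delta_0>0$ such that for every $\delta\in(0,\delta_0)$ there is $\theta_\delta\in\mathbb R$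 with the following property. For every $\theta>2$ with $\theta>\theta_\delta$ and every $y_\delta\in\mathbb R^n$ with $\|y_\delta-y^\dagger\|\le\delta$, the ADGD iterates $w^{(k)}_\delta$ for the data $y=y_\delta$ satisfy $$w^{(k_\delta)}_\delta\in\mathcal M_{w^\dagger}.$$ Moreover, there are integers $0<\underline k<k_\delta<\overline k$ such that $w^{(k)}_\delta\in\mathcal M_{w^\dagger}$ for all integers $k\in[\underline k,\overline k]$. -/

import Mathlib

open Filter Topology

namespace IterReg

noncomputable section

section ConvexAnalysis

variable {E : Type*} [NormedAddCommGroup E] [InnerProductSpace ℝ E]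

/-- The class `Γ₀` of proper, convex, lower semicontinuous functions with values in
`ℝ ∪ {+∞}`; the value `-∞` of `EReal` is excluded, and convexity is convexity of the epigraph. -/
structure Gamma0 (R : E → EReal) : Prop where
  ne_bot : ∀ w, R w ≠ ⊥
  exists_ne_top : ∃ w, R w ≠ ⊤
  convex_epigraph : Convex ℝ {q : E × ℝ | R q.1 ≤ (q.2 : EReal)}
  lsc : LowerSemicontinuous R

/-- The subdifferential of `R` at `w`; it is empty when `w` is outside the domain of `R`. -/
def subdiff (R : E → EReal) (w : E) : Set E :=
  {u | R w ≠ ⊤ ∧ ∀ w', R w + ((inner ℝ u (w' - w) : ℝ) : EReal) ≤ R w'}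

/-- The conjugate `R^*(u) = sup_w (⟨u, w⟩ - R(w))`. -/
def conjugate (R : E → EReal) (u : E) : EReal :=
  ⨆ w, (((inner ℝ u w : ℝ) : EReal) - R w)

/-- `x` minimizes `R(·) + ‖· - w‖² / (2γ)`. -/
def IsProxPoint (γ : ℝ) (R : E → EReal) (w x : E) : Prop :=
  ∀ x', R x + ((1 / (2 * γ) * ‖x - w‖ ^ 2 : ℝ) : EReal)
    ≤ R x' + ((1 / (2 * γ) * ‖x' - w‖ ^ 2 : ℝ) : EReal)

/-- The proximity operator `prox_{γR}(w)`: the minimizer of `R(·) + ‖· - w‖² / (2γ)`, which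
exists and is unique for `R ∈ Γ₀` and `γ > 0`. -/
def prox (γ : ℝ) (R : E → EReal) (w : E) : E :=
  Classical.epsilon (IsProxPoint γ R w)

/-- `R_α = R + (α/2) ‖·‖²`. -/
def regularized (α : ℝ) (R : E → EReal) (w : E) : EReal :=
  R w + ((α / 2 * ‖w‖ ^ 2 : ℝ) : EReal)

/-- Continuity at `x`, relative to `M`, of a set-valued map `S`, in the sense of
Painlevé and Kuratowski: inner and outer semicontinuity. -/
structure SetContinuousWithinAt (S : E → Set E) (M : Set E) (x : E) : Prop where
  inner_semicontinuous : ∀ u ∈ S x, ∀ V ∈ 𝓝 u, ∀ᶠ x' in 𝓝[M] x, (S x' ∩ V).Nonempty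
  outer_semicontinuous : ∀ u, (∀ V ∈ 𝓝 u, ∃ᶠ x' in 𝓝[M] x, (S x' ∩ V).Nonempty) → u ∈ S x

/-- `Φ = 0` is a regular `C²` system of equations for `M` near `w`. The existence of such a `Φ`
says that `M` is a `C²` manifold around `w`; the tangent space of `M` at `w` is then the kernel
of the derivative of `Φ` at `w`. -/
structure IsDefiningMap (M : Set E) (w : E) {m : ℕ} (Φ : E → EuclideanSpace ℝ (Fin m)) :
    Prop where
  mem : w ∈ M
  contDiffAt : ContDiffAt ℝ 2 Φ w
  surjective : Function.Surjective (fderiv ℝ Φ w)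
  mem_iff : ∀ᶠ x in 𝓝 w, x ∈ M ↔ Φ x = 0

/-- The model tangent subspace at `w`: the orthogonal complement of the linear space spanned by
the differences of elements of `∂R(w)`. -/
def modelTangent (R : E → EReal) (w : E) : Submodule ℝ E :=
  (vectorSpan ℝ (subdiff R w))ᗮ

/-- `R` is partly smooth at `w` relative to `M`. -/
structure PartlySmooth (R : E → EReal) (w : E) (M : Set E) : Prop where
  subdiff_nonempty : (subdiff R w).Nonempty
  /-- `M` is a `C²` manifold around `w`, whose tangent space at `w` is the model tangent
  subspace. -/
  manifold_sharp : ∃ (m : ℕ) (Φ : E → EuclideanSpace ℝ (Fin m)),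
    IsDefiningMap M w Φ ∧ LinearMap.ker (fderiv ℝ Φ w : E →ₗ[ℝ] EuclideanSpace ℝ (Fin m))
      = modelTangent R w
  /-- The restriction of `R` to `M` is `C²` near `w`: it has a `C²` local extension. -/
  smooth : ∃ g : E → ℝ, ContDiffAt ℝ 2 g w ∧ ∀ᶠ x in 𝓝[M] w, R x = (g x : EReal)
  /-- The subdifferential is continuous near `w` along `M`. -/
  subdiff_continuous : ∀ᶠ x in 𝓝[M] w, SetContinuousWithinAt (subdiff R) M x

end ConvexAnalysis

section Algorithms

variable {E F : Type*} [NormedAddCommGroup E] [InnerProductSpace ℝ E] [CompleteSpace E]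
  [NormedAddCommGroup F] [InnerProductSpace ℝ F] [CompleteSpace F]

/-- `w` solves `min R_α(w)` subject to `X w = y`. -/
def IsPrimalSolution (R : E → EReal) (α : ℝ) (X : E →L[ℝ] F) (y : F) (w : E) : Prop :=
  X w = y ∧ ∀ w', X w' = y → regularized α R w ≤ regularized α R w'

/-- The dual objective `φ(v) = R_α^*(-Xᵀ v) + ⟨y, v⟩`. -/
def dualObjective (R : E → EReal) (α : ℝ) (X : E →L[ℝ] F) (y v : F) : EReal :=
  conjugate (regularized α R) (-(X.adjoint v)) + ((inner ℝ y v : ℝ) : EReal)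

/-- `v` minimizes the dual objective. -/
def IsDualSolution (R : E → EReal) (α : ℝ) (X : E →L[ℝ] F) (y v : F) : Prop :=
  ∀ v', dualObjective R α X y v ≤ dualObjective R α X y v'

/-- The step size `γ = α ‖X‖⁻²`. -/
def stepSize (α : ℝ) (X : E →L[ℝ] F) : ℝ := α * (‖X‖ ^ 2)⁻¹

/-- The primal point attached to a dual point: `prox_{α⁻¹R}(-α⁻¹ Xᵀ v)`. -/
def primalPoint (R : E → EReal) (α : ℝ) (X : E →L[ℝ] F) (v : F) : E :=
  prox α⁻¹ R (-(α⁻¹ • X.adjoint v))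

/-- One dual gradient step: `v + γ (X prox_{α⁻¹R}(-α⁻¹ Xᵀ v) - y)`. -/
def dualStep (R : E → EReal) (α : ℝ) (X : E →L[ℝ] F) (y v : F) : F :=
  v + stepSize α X • (X (primalPoint R α X v) - y)

/-- The dual iterates `v^(k)` of dual gradient descent, started at `0`. -/
def dgdV (R : E → EReal) (α : ℝ) (X : E →L[ℝ] F) (y : F) : ℕ → F
  | 0 => 0
  | k + 1 => dualStep R α X y (dgdV R α X y k)

/-- The pair `(v^(k), u^(k-1))` of accelerated dual gradient descent with inertial parameter `θ`:
`v^(0) = u^(-1) = 0`, `u^(k)` is the dual gradient step from `v^(k)`, and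
`v^(k+1) = u^(k) + (k-1)/(k+θ) (u^(k) - u^(k-1))`. -/
def adgdState (R : E → EReal) (α : ℝ) (X : E →L[ℝ] F) (y : F) (θ : ℝ) : ℕ → F × F
  | 0 => (0, 0)
  | k + 1 =>
    let s := adgdState R α X y θ k
    let u := dualStep R α X y s.1
    (u + (((k : ℝ) - 1) / ((k : ℝ) + θ)) • (u - s.2), u)

/-- The dual iterates `u^(k)` of accelerated dual gradient descent. -/
def adgdU (R : E → EReal) (α : ℝ) (X : E →L[ℝ] F) (y : F) (θ : ℝ) (k : ℕ) : F :=
  dualStep R α X y (adgdState R α X y θ k).1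

/-- The primal iterates `w^(k) = prox_{α⁻¹R}(-α⁻¹ Xᵀ u^(k))` of accelerated dual gradient
descent. -/
def adgdW (R : E → EReal) (α : ℝ) (X : E →L[ℝ] F) (y : F) (θ : ℝ) (k : ℕ) : E :=
  primalPoint R α X (adgdU R α X y θ k)

end Algorithms

/-- The early stopping time `k_δ = ⌈c δ^{-1/2}⌉`. -/
def stopTime (c δ : ℝ) : ℕ := ⌈c * δ ^ (-(1 / 2) : ℝ)⌉₊

end

end IterReg

namespace IterReg

section Subdifferential

variable {E : Type*} [NormedAddCommGroup E] [InnerProductSpace ℝ E]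

theorem Gamma0.exists_real {R : E → EReal} (hR : Gamma0 R) {w : E} (hw : R w ≠ ⊤) :
    ∃ r : ℝ, R w = r :=
  ⟨(R w).toReal, (EReal.coe_toReal hw (hR.ne_bot w)).symm⟩

theorem Gamma0.mem_subdiff_iff {R : E → EReal} (hR : Gamma0 R) {w u : E} {r : ℝ}
    (hr : R w = r) :
    u ∈ subdiff R w ↔ ∀ (w' : E) (r' : ℝ), R w' = r' → r + inner ℝ u (w' - w) ≤ r' := by
  constructor
  · rintro ⟨-, h⟩ w' r' hr'
    have := h w'
    rw [hr, hr'] at this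
    exact_mod_cast this
  · intro h
    refine ⟨by simp [hr], fun w' => ?_⟩
    by_cases hw' : R w' = ⊤
    · simp [hw']
    · obtain ⟨r', hr'⟩ := hR.exists_real hw'
      rw [hr, hr']
      exact_mod_cast h w' r' hr'

theorem Gamma0.inner_subdiff_nonneg {R : E → EReal} (hR : Gamma0 R) {w w' u u' : E}
    (hu : u ∈ subdiff R w) (hu' : u' ∈ subdiff R w') : 0 ≤ inner ℝ (u - u') (w - w') := by
  obtain ⟨r, hr⟩ := hR.exists_real hu.1
  obtain ⟨r', hr'⟩ := hR.exists_real hu'.1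
  have h1 := (hR.mem_subdiff_iff hr).1 hu w' r' hr'
  have h2 := (hR.mem_subdiff_iff hr').1 hu' w r hr
  simp only [inner_sub_left, inner_sub_right] at *
  linarith

/-- A quadratic perturbation does not affect the subgradient inequality of a convex function. -/
theorem Gamma0.mem_subdiff_of_quadratic {R : E → EReal} (hR : Gamma0 R) {w g : E} {r κ : ℝ}
    (hr : R w = r) (h : ∀ (w' : E) (r' : ℝ), R w' ≤ r' →
      r + inner ℝ g (w' - w) - κ * ‖w' - w‖ ^ 2 ≤ r') : g ∈ subdiff R w := by
  rw [hR.mem_subdiff_iff hr]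
  intro w' r' hr'
  have key : ∀ t : ℝ, 0 < t → t < 1 →
      r + inner ℝ g (w' - w) - t * (κ * ‖w' - w‖ ^ 2) ≤ r' := by
    intro t ht ht1
    have hmem := hR.convex_epigraph (x := (w, r)) (by simp [hr]) (y := (w', r')) (by simp [hr'])
      (sub_nonneg.2 ht1.le) ht.le (by ring)
    have hle := h _ _ hmem
    have hw : (1 - t) • w + t • w' - w = t • (w' - w) := by module
    simp only [Prod.fst_add, Prod.smul_fst, Prod.snd_add, Prod.smul_snd, smul_eq_mul, hw,
      inner_smul_right, norm_smul, Real.norm_eq_abs, mul_pow, sq_abs] at hle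
    refine le_of_mul_le_mul_left ?_ ht
    nlinarith
  have hlim : Tendsto (fun t : ℝ => r + inner ℝ g (w' - w) - t * (κ * ‖w' - w‖ ^ 2)) (𝓝[>] 0)
      (𝓝 (r + inner ℝ g (w' - w) - 0 * (κ * ‖w' - w‖ ^ 2))) :=
    Tendsto.mono_left (Continuous.tendsto (by fun_prop) _) nhdsWithin_le_nhds
  rw [zero_mul, sub_zero] at hlim
  refine le_of_tendsto hlim ?_
  filter_upwards [Ioo_mem_nhdsGT (zero_lt_one' ℝ)] with t ht using key t ht.1 ht.2

theorem Gamma0.sub_smul_mem_subdiff {R : E → EReal} (hR : Gamma0 R) {α : ℝ} {w u : E}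
    (hu : u ∈ subdiff (regularized α R) w) : u - α • w ∈ subdiff R w := by
  have hw : R w ≠ ⊤ := fun h => hu.1 (by rw [regularized, h, EReal.top_add_coe])
  obtain ⟨r, hr⟩ := hR.exists_real hw
  refine hR.mem_subdiff_of_quadratic (κ := α / 2) hr fun w' r' hr' => ?_
  have h := (hu.2 w').trans (add_le_add_left hr' _)
  rw [regularized, hr] at h
  have h' : r + α / 2 * ‖w‖ ^ 2 + inner ℝ u (w' - w) ≤ r' + α / 2 * ‖w'‖ ^ 2 := by
    exact_mod_cast h
  rw [@norm_sub_sq_real]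
  simp only [inner_sub_left, inner_sub_right, inner_smul_left, real_inner_self_eq_norm_sq,
    RCLike.conj_to_real] at *
  rw [real_inner_comm w w']
  linarith

theorem Gamma0.add_smul_mem_subdiff {R : E → EReal} (hR : Gamma0 R) {α : ℝ} (hα : 0 ≤ α)
    {w u : E} (hu : u ∈ subdiff R w) : u + α • w ∈ subdiff (regularized α R) w := by
  obtain ⟨r, hr⟩ := hR.exists_real hu.1
  refine ⟨by rw [regularized, hr, ← EReal.coe_add]; exact EReal.coe_ne_top _, fun w' => ?_⟩
  by_cases hw' : R w' = ⊤
  · rw [show regularized α R w' = ⊤ by rw [regularized, hw', EReal.top_add_coe]]; exact le_top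
  obtain ⟨r', hr'⟩ := hR.exists_real hw'
  have h := (hR.mem_subdiff_iff hr).1 hu w' r' hr'
  rw [regularized, regularized, hr, hr']
  norm_cast
  have hsq := mul_nonneg hα (sq_nonneg ‖w' - w‖)
  rw [@norm_sub_sq_real] at hsq
  simp only [inner_sub_right, inner_add_left, inner_smul_left, real_inner_self_eq_norm_sq,
    RCLike.conj_to_real] at *
  rw [real_inner_comm w w'] at hsq
  linarith

theorem Gamma0.vectorSpan_regularized {R : E → EReal} (hR : Gamma0 R) {α : ℝ} (hα : 0 ≤ α)
    (w : E) : vectorSpan ℝ (subdiff R w) ≤ vectorSpan ℝ (subdiff (regularized α R) w) := by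
  refine Submodule.span_mono ?_
  rintro _ ⟨a, ha, b, hb, rfl⟩
  exact ⟨a + α • w, hR.add_smul_mem_subdiff hα ha, b + α • w, hR.add_smul_mem_subdiff hα hb,
    by simp⟩

end Subdifferential

section Prox

variable {E : Type*} [NormedAddCommGroup E] [InnerProductSpace ℝ E]

theorem Gamma0.isProxPoint_iff {R : E → EReal} (hR : Gamma0 R) {γ : ℝ} (hγ : 0 < γ) {z x : E} :
    IsProxPoint γ R z x ↔ γ⁻¹ • (z - x) ∈ subdiff R x := by
  have expand : ∀ x' : E, ‖x' - z‖ ^ 2 =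
      ‖x - z‖ ^ 2 - 2 * inner ℝ (z - x) (x' - x) + ‖x' - x‖ ^ 2 := by
    intro x'
    have : x' - z = (x' - x) - (z - x) := by abel
    rw [this, @norm_sub_sq_real, real_inner_comm, norm_sub_rev z x]
    ring
  have hγ' : 1 / (2 * γ) = γ⁻¹ / 2 := by field_simp
  constructor
  · intro h
    obtain ⟨x₀, hx₀⟩ := hR.exists_ne_top
    have hx : R x ≠ ⊤ := by
      intro hx
      obtain ⟨r₀, hr₀⟩ := hR.exists_real hx₀
      have := h x₀
      rw [hx, hr₀, EReal.top_add_coe, ← EReal.coe_add, top_le_iff] at this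
      exact EReal.coe_ne_top _ this
    obtain ⟨r, hr⟩ := hR.exists_real hx
    refine hR.mem_subdiff_of_quadratic (κ := γ⁻¹ / 2) hr fun x' r' hr' => ?_
    have h' := (h x').trans (add_le_add_left hr' _)
    rw [hr] at h'
    norm_cast at h'
    rw [expand x', hγ'] at h'
    rw [inner_smul_left, RCLike.conj_to_real]
    linarith
  · intro h x'
    obtain ⟨r, hr⟩ := hR.exists_real h.1
    by_cases hx' : R x' = ⊤
    · rw [hx', EReal.top_add_coe]; exact le_top
    obtain ⟨r', hr'⟩ := hR.exists_real hx'
    have h' := (hR.mem_subdiff_iff hr).1 h x' r' hr'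
    rw [hr, hr']
    norm_cast
    rw [expand x', hγ']
    rw [inner_smul_left, RCLike.conj_to_real] at h'
    have : 0 ≤ γ⁻¹ / 2 * ‖x' - x‖ ^ 2 := by positivity
    linarith

theorem Gamma0.exists_isProxPoint [FiniteDimensional ℝ E] {R : E → EReal} (hR : Gamma0 R)
    {w₀ : E} (hw₀ : (subdiff R w₀).Nonempty) {γ : ℝ} (hγ : 0 < γ) (z : E) :
    ∃ x, IsProxPoint γ R z x := by
  obtain ⟨u, hu⟩ := hw₀
  obtain ⟨r₀, hr₀⟩ := hR.exists_real hu.1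
  set a : ℝ := 1 / (2 * γ) with ha
  have ha0 : 0 < a := by positivity
  set b : E := u + (2 * a) • (w₀ - z) with hb
  have hlsc : LowerSemicontinuous fun x => R x + ((a * ‖x - z‖ ^ 2 : ℝ) : EReal) := by
    refine hR.lsc.add' ?_ fun x => ?_
    · exact (continuous_coe_real_ereal.comp (by fun_prop)).lowerSemicontinuous
    · exact EReal.continuousAt_add (Or.inr (EReal.coe_ne_bot _)) (Or.inr (EReal.coe_ne_top _))
  obtain ⟨x, -, hx⟩ := LowerSemicontinuousOn.exists_isMinOn
    (s := Metric.closedBall w₀ (‖b‖ / a)) ⟨w₀, by simp; positivity⟩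
    (isCompact_closedBall _ _) (hlsc.lowerSemicontinuousOn _)
  refine ⟨x, fun x' => ?_⟩
  by_cases hx' : x' ∈ Metric.closedBall w₀ (‖b‖ / a)
  · exact hx hx'
  refine (hx (by simp; positivity : w₀ ∈ Metric.closedBall w₀ (‖b‖ / a))).trans ?_
  simp only
  by_cases hx't : R x' = ⊤
  · rw [hx't, EReal.top_add_coe]; exact le_top
  obtain ⟨r', hr'⟩ := hR.exists_real hx't
  have h := (hR.mem_subdiff_iff hr₀).1 hu x' r' hr'
  rw [hr₀, hr']
  norm_cast
  rw [Metric.mem_closedBall, not_le, dist_eq_norm, div_lt_iff₀ ha0] at hx'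
  have h1 : x' - z = (x' - w₀) + (w₀ - z) := by abel
  have h2 : inner ℝ b (x' - w₀) = inner ℝ u (x' - w₀) + 2 * a * inner ℝ (x' - w₀) (w₀ - z) := by
    rw [hb, inner_add_left, inner_smul_left, RCLike.conj_to_real, real_inner_comm (w₀ - z)]
  have h3 := neg_le_of_abs_le (abs_real_inner_le_norm b (x' - w₀))
  rw [h1, @norm_add_sq_real]
  nlinarith [norm_nonneg (x' - w₀)]

end Prox

section Identification

variable {E : Type*} [NormedAddCommGroup E] [InnerProductSpace ℝ E]

theorem exists_ball_of_mem_intrinsicInterior {s : Set E} {x : E}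
    (hx : x ∈ intrinsicInterior ℝ s) :
    ∃ ε > 0, ∀ v ∈ vectorSpan ℝ s, ‖v‖ < ε → x + v ∈ s := by
  obtain ⟨y, hy, rfl⟩ := mem_intrinsicInterior.1 hx
  obtain ⟨ε, hε, hball⟩ := Metric.mem_nhds_iff.1 (mem_interior_iff_mem_nhds.1 hy)
  refine ⟨ε, hε, fun v hv hvε => ?_⟩
  have hmem : (y : E) + v ∈ affineSpan ℝ s := by
    rw [add_comm]
    exact AffineSubspace.vadd_mem_of_mem_direction (by rwa [direction_affineSpan]) y.2
  have : (⟨(y : E) + v, hmem⟩ : affineSpan ℝ s) ∈ Metric.ball y ε := by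
    rw [Metric.mem_ball, Subtype.dist_eq, dist_eq_norm]
    simpa using hvε
  exact hball this

variable [FiniteDimensional ℝ E]

/-- Near `w`, every point can be moved into the manifold along a complement of the kernel of the
derivative of a defining map. -/
theorem IsDefiningMap.eventually_exists_sub_mem {M : Set E} {w : E} {m : ℕ}
    {Φ : E → EuclideanSpace ℝ (Fin m)} (hΦ : IsDefiningMap M w Φ) {S : Submodule ℝ E}
    (hker : LinearMap.ker (fderiv ℝ Φ w : E →ₗ[ℝ] EuclideanSpace ℝ (Fin m)) = Sᗮ)
    {U : Set E} (hU : U ∈ 𝓝 w) : ∀ᶠ x in 𝓝 w, ∃ q ∈ U, q ∈ M ∧ x - q ∈ S := by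
  have hderiv : HasStrictFDerivAt (fun x => (Φ x, Sᗮ.orthogonalProjectionOnto x))
      ((fderiv ℝ Φ w).prod Sᗮ.orthogonalProjectionOnto) w :=
    (hΦ.contDiffAt.hasStrictFDerivAt two_ne_zero).prodMk
      Sᗮ.orthogonalProjectionOnto.hasStrictFDerivAt
  have hsurj : ((fderiv ℝ Φ w).prod Sᗮ.orthogonalProjectionOnto).range = ⊤ := by
    refine LinearMap.range_eq_top.2 ?_
    rintro ⟨z, t⟩
    obtain ⟨x, hx⟩ := hΦ.surjective z
    have hmem : ∀ e : Sᗮ, fderiv ℝ Φ w e = 0 := fun e => by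
      have : (e : E) ∈ LinearMap.ker (fderiv ℝ Φ w : E →ₗ[ℝ] EuclideanSpace ℝ (Fin m)) :=
        by rw [hker]; exact e.2
      exact this
    refine ⟨x + ((t - Sᗮ.orthogonalProjectionOnto x : Sᗮ) : E), ?_⟩
    refine Prod.ext ?_ ?_
    · change fderiv ℝ Φ w _ = z
      rw [map_add, hmem, hx, add_zero]
    · change Sᗮ.orthogonalProjectionOnto _ = t
      rw [map_add, Submodule.orthogonalProjectionOnto_mem_subspace_eq_self]
      abel
  have hmap := hderiv.map_nhds_eq_of_surj hsurj
  have hΦw : Φ w = 0 := (hΦ.mem_iff.self_of_nhds).1 hΦ.mem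
  have himg : (fun x => (Φ x, Sᗮ.orthogonalProjectionOnto x)) '' (U ∩ {x | x ∈ M ↔ Φ x = 0}) ∈
      𝓝 ((0 : EuclideanSpace ℝ (Fin m)), Sᗮ.orthogonalProjectionOnto w) := by
    have := image_mem_map (m := fun x => (Φ x, Sᗮ.orthogonalProjectionOnto x))
      (inter_mem hU hΦ.mem_iff)
    rwa [hmap, hΦw] at this
  have hcont : Tendsto (fun x => ((0 : EuclideanSpace ℝ (Fin m)), Sᗮ.orthogonalProjectionOnto x))
      (𝓝 w) (𝓝 (0, Sᗮ.orthogonalProjectionOnto w)) :=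
    Continuous.tendsto (by fun_prop) w
  filter_upwards [hcont himg] with x hx
  obtain ⟨q, ⟨hqU, hqM⟩, hq⟩ := hx
  obtain ⟨h0, hproj⟩ := Prod.ext_iff.1 hq
  refine ⟨q, hqU, hqM.2 h0, ?_⟩
  rw [← Submodule.orthogonal_orthogonal S, ← Submodule.orthogonalProjectionOnto_eq_zero_iff, map_sub,
    sub_eq_zero]
  exact hproj.symm

/-- Finite identification: points close to `w` carrying a subgradient close to a relative
interior subgradient at `w` lie in the manifold of partial smoothness. -/
theorem PartlySmooth.eventually_mem {R : E → EReal} (hR : Gamma0 R) {w : E} {M : Set E}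
    (hM : PartlySmooth R w M) {ξ : E} {ε : ℝ} (hε : 0 < ε)
    (hξ : ∀ v ∈ vectorSpan ℝ (subdiff R w), ‖v‖ ≤ ε → ξ + v ∈ subdiff R w) :
    ∀ᶠ x in 𝓝 w, ∀ u ∈ subdiff R x, ‖u - ξ‖ < ε / 2 → x ∈ M := by
  obtain ⟨m, Φ, hΦ, hker⟩ := hM.manifold_sharp
  set S := vectorSpan ℝ (subdiff R w) with hS
  have hinner := (hM.subdiff_continuous.self_of_nhdsWithin hΦ.mem).inner_semicontinuous
  have hcompact : IsCompact ((S : Set E) ∩ Metric.sphere 0 1) :=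
    (isCompact_sphere 0 1).inter_left S.closed_of_finiteDimensional
  have hnear : ∀ᶠ q in 𝓝 w, ∀ e ∈ (S : Set E) ∩ Metric.sphere 0 1,
      q ∈ M → ∃ η ∈ subdiff R q, ε / 2 < inner ℝ (η - ξ) e := by
    refine hcompact.eventually_forall_of_forall_eventually fun e he => ?_
    have hnorm : ‖e‖ = 1 := by simpa using he.2
    have hmem : ξ + ε • e ∈ subdiff R w :=
      hξ _ (S.smul_mem _ he.1) (by rw [norm_smul, hnorm, Real.norm_of_nonneg hε.le, mul_one])
    have hcont : Continuous fun a : E × E => inner ℝ (a.1 - ξ) a.2 := by fun_prop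
    have hopen : {a : E × E | ε / 2 < inner ℝ (a.1 - ξ) a.2} ∈ 𝓝 (ξ + ε • e, e) := by
      refine hcont.continuousAt.eventually (lt_mem_nhds ?_)
      simp only [add_sub_cancel_left, inner_smul_left, RCLike.conj_to_real,
        real_inner_self_eq_norm_sq, hnorm]
      linarith
    rw [nhds_prod_eq] at hopen
    obtain ⟨V, hV, W, hW, hVW⟩ := mem_prod_iff.1 hopen
    rw [nhds_prod_eq]
    filter_upwards [prod_mem_prod (mem_nhdsWithin_iff_eventually.1 (hinner _ hmem V hV)) hW]
      with a ha haM
    obtain ⟨η, hη, hηV⟩ := ha.1 haM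
    exact ⟨η, hη, hVW (Set.mk_mem_prod hηV ha.2)⟩
  filter_upwards [hΦ.eventually_exists_sub_mem hker hnear] with x hx u hu huξ
  obtain ⟨q, hq, hqM, hqS⟩ := hx
  by_contra hxM
  have hne : x - q ≠ 0 := fun h => hxM (by rwa [sub_eq_zero.1 h])
  have hpos : 0 < ‖x - q‖ := norm_pos_iff.2 hne
  obtain ⟨η, hη, hlt⟩ := hq (‖x - q‖⁻¹ • (x - q))
    ⟨S.smul_mem _ hqS, by simp [norm_smul, hpos.ne']⟩ hqM
  have hmono := hR.inner_subdiff_nonneg hu hη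
  have hcs := real_inner_le_norm (u - ξ) (x - q)
  rw [inner_smul_right, inv_mul_eq_div, lt_div_iff₀ hpos] at hlt
  have hsplit : inner ℝ (u - η) (x - q) = inner ℝ (u - ξ) (x - q) - inner ℝ (η - ξ) (x - q) := by
    rw [← inner_sub_left]; congr 1; abel
  have := mul_lt_mul_of_pos_right huξ hpos
  linarith

end Identification

section Dual

variable {E F : Type*} [NormedAddCommGroup E] [InnerProductSpace ℝ E] [CompleteSpace E]
  [NormedAddCommGroup F] [InnerProductSpace ℝ F] [CompleteSpace F]

theorem Gamma0.isProxPoint_primal_iff {R : E → EReal} (hR : Gamma0 R) {α : ℝ} (hα : 0 < α)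
    (X : E →L[ℝ] F) {v : F} {x : E} : IsProxPoint α⁻¹ R (-(α⁻¹ • X.adjoint v)) x ↔
      -(X.adjoint v) - α • x ∈ subdiff R x := by
  rw [hR.isProxPoint_iff (inv_pos.2 hα), inv_inv, smul_sub, smul_neg, smul_inv_smul₀ hα.ne']

theorem Gamma0.primalPoint_mem_subdiff [FiniteDimensional ℝ E] {R : E → EReal} (hR : Gamma0 R)
    {w₀ : E} (hw₀ : (subdiff R w₀).Nonempty) {α : ℝ} (hα : 0 < α) (X : E →L[ℝ] F) (v : F) :
    -(X.adjoint v) - α • primalPoint R α X v ∈ subdiff R (primalPoint R α X v) :=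
  (hR.isProxPoint_primal_iff hα X).1
    (Classical.epsilon_spec (hR.exists_isProxPoint hw₀ (inv_pos.2 hα) _))

theorem Gamma0.mul_norm_sub_sq_le {R : E → EReal} (hR : Gamma0 R) {α : ℝ} (X : E →L[ℝ] F)
    {v v' : F} {x x' : E} (hx : -(X.adjoint v) - α • x ∈ subdiff R x)
    (hx' : -(X.adjoint v') - α • x' ∈ subdiff R x') :
    α * ‖x - x'‖ ^ 2 ≤ -inner ℝ (v - v') (X (x - x')) := by
  have h := hR.inner_subdiff_nonneg hx hx'
  have h1 : -(X.adjoint v) - α • x - (-(X.adjoint v') - α • x') =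
      -(X.adjoint (v - v')) - α • (x - x') := by
    rw [map_sub, smul_sub]; abel
  rw [h1, inner_sub_left, inner_neg_left, inner_smul_left, RCLike.conj_to_real,
    ContinuousLinearMap.adjoint_inner_left, real_inner_self_eq_norm_sq] at h
  linarith

theorem Gamma0.norm_sub_le_of_mem_subdiff {R : E → EReal} (hR : Gamma0 R) {α : ℝ} (hα : 0 < α)
    (X : E →L[ℝ] F) {v v' : F} {x x' : E} (hx : -(X.adjoint v) - α • x ∈ subdiff R x)
    (hx' : -(X.adjoint v') - α • x' ∈ subdiff R x') :
    ‖x - x'‖ ≤ α⁻¹ * ‖X‖ * ‖v - v'‖ := by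
  rcases (norm_nonneg (x - x')).eq_or_lt with h0 | h0
  · rw [← h0]; positivity
  have h := hR.mul_norm_sub_sq_le X hx hx'
  have h1 := neg_le_of_abs_le (abs_real_inner_le_norm (v - v') (X (x - x')))
  have h2 := mul_le_mul_of_nonneg_left (X.le_opNorm (x - x')) (norm_nonneg (v - v'))
  rw [mul_assoc, inv_mul_eq_div, le_div_iff₀ hα]
  refine le_of_mul_le_mul_right ?_ h0
  linarith

theorem norm_dualStep_sub_dualStep (R : E → EReal) {α : ℝ} (hα : 0 ≤ α) (X : E →L[ℝ] F)
    (y y' v : F) : ‖dualStep R α X y v - dualStep R α X y' v‖ = stepSize α X * ‖y - y'‖ := by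
  have hγ : 0 ≤ stepSize α X := by unfold stepSize; positivity
  have : dualStep R α X y v - dualStep R α X y' v = stepSize α X • (y' - y) := by
    rw [dualStep, dualStep]; module
  rw [this, norm_smul, Real.norm_of_nonneg hγ, norm_sub_rev]

variable [FiniteDimensional ℝ E]

theorem Gamma0.primalPoint_eq {R : E → EReal} (hR : Gamma0 R) {α : ℝ} (hα : 0 < α)
    (X : E →L[ℝ] F) {v : F} {x : E} (hx : -(X.adjoint v) - α • x ∈ subdiff R x) :
    primalPoint R α X v = x := by
  have h := hR.norm_sub_le_of_mem_subdiff hα X (hR.primalPoint_mem_subdiff ⟨_, hx⟩ hα X v) hx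
  rw [sub_self, norm_zero, mul_zero] at h
  exact sub_eq_zero.1 (norm_le_zero_iff.1 h)

theorem Gamma0.continuous_primalPoint {R : E → EReal} (hR : Gamma0 R) {w₀ : E}
    (hw₀ : (subdiff R w₀).Nonempty) {α : ℝ} (hα : 0 < α) (X : E →L[ℝ] F) :
    Continuous (primalPoint R α X) := by
  refine (LipschitzWith.of_dist_le_mul (K := ⟨α⁻¹ * ‖X‖, by positivity⟩) fun v v' => ?_).continuous
  rw [dist_eq_norm, dist_eq_norm]
  exact hR.norm_sub_le_of_mem_subdiff hα X (hR.primalPoint_mem_subdiff hw₀ hα X v)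
    (hR.primalPoint_mem_subdiff hw₀ hα X v')

theorem Gamma0.norm_dualStep_sub_le {R : E → EReal} (hR : Gamma0 R) {w₀ : E}
    (hw₀ : (subdiff R w₀).Nonempty) {α : ℝ} (hα : 0 < α) (X : E →L[ℝ] F) (y v v' : F) :
    ‖dualStep R α X y v - dualStep R α X y v'‖ ≤ ‖v - v'‖ := by
  have h := hR.mul_norm_sub_sq_le X (hR.primalPoint_mem_subdiff hw₀ hα X v)
    (hR.primalPoint_mem_subdiff hw₀ hα X v')
  set e := primalPoint R α X v - primalPoint R α X v' with he
  have hstep : dualStep R α X y v - dualStep R α X y v' = (v - v') + stepSize α X • X e := by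
    rw [he, map_sub, dualStep, dualStep]; module
  have hγ : 0 ≤ stepSize α X := by unfold stepSize; positivity
  have hXe : stepSize α X * ‖X e‖ ^ 2 ≤ α * ‖e‖ ^ 2 := by
    have h1 : ‖X e‖ ^ 2 ≤ ‖X‖ ^ 2 * ‖e‖ ^ 2 := by
      rw [← mul_pow]; exact pow_le_pow_left₀ (norm_nonneg _) (X.le_opNorm e) 2
    have h2 : stepSize α X * ‖X‖ ^ 2 ≤ α := by
      unfold stepSize
      rcases eq_or_ne (‖X‖ ^ 2) 0 with h0 | h0
      · rw [h0, mul_zero]; exact hα.le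
      · rw [inv_mul_cancel_right₀ h0]
    nlinarith [sq_nonneg ‖e‖]
  refine le_of_sq_le_sq ?_ (norm_nonneg _)
  rw [hstep, @norm_add_sq_real, inner_smul_right, norm_smul, Real.norm_of_nonneg hγ]
  nlinarith [sq_nonneg ‖e‖]

theorem Gamma0.norm_dgdV_sub_le {R : E → EReal} (hR : Gamma0 R) {w₀ : E}
    (hw₀ : (subdiff R w₀).Nonempty) {α : ℝ} (hα : 0 < α) (X : E →L[ℝ] F) (y y' : F) (k : ℕ) :
    ‖dgdV R α X y k - dgdV R α X y' k‖ ≤ k * (stepSize α X * ‖y - y'‖) := by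
  induction k with
  | zero => simp [dgdV]
  | succ k ih =>
    have h1 := hR.norm_dualStep_sub_le hw₀ hα X y (dgdV R α X y k) (dgdV R α X y' k)
    have h2 := norm_dualStep_sub_dualStep R hα.le X y y' (dgdV R α X y' k)
    have h3 := norm_sub_le_norm_sub_add_norm_sub (dualStep R α X y (dgdV R α X y k))
      (dualStep R α X y (dgdV R α X y' k)) (dualStep R α X y' (dgdV R α X y' k))
    push_cast
    rw [dgdV, dgdV]
    linarith

theorem Gamma0.norm_dgdV_succ_sub_le {R : E → EReal} (hR : Gamma0 R) {w₀ : E}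
    (hw₀ : (subdiff R w₀).Nonempty) {α : ℝ} (hα : 0 < α) (X : E →L[ℝ] F) (y : F) (k : ℕ) :
    ‖dgdV R α X y (k + 1) - dgdV R α X y k‖ ≤ ‖dualStep R α X y 0‖ := by
  induction k with
  | zero => simp [dgdV]
  | succ k ih => exact (hR.norm_dualStep_sub_le hw₀ hα X y _ _).trans ih

/-- As `θ → ∞`, the states of accelerated dual gradient descent converge to those of dual gradient
descent, uniformly over bounded sets of data. -/
theorem Gamma0.eventually_adgdState_close {R : E → EReal} (hR : Gamma0 R) {w₀ : E}
    (hw₀ : (subdiff R w₀).Nonempty) {α : ℝ} (hα : 0 < α) (X : E →L[ℝ] F) (y₀ : F) (δ : ℝ)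
    (k : ℕ) {ε : ℝ} (hε : 0 < ε) :
    ∀ᶠ θ in atTop, ∀ y, ‖y - y₀‖ ≤ δ →
      ‖(adgdState R α X y θ k).1 - dgdV R α X y k‖ ≤ ε ∧
      ‖(adgdState R α X y θ k).2 - dgdV R α X y k‖ ≤ ε := by
  induction k generalizing ε with
  | zero => simp [adgdState, dgdV, hε.le]
  | succ k ih =>
    set C : ℝ := ε + (‖dualStep R α X y₀ 0‖ + stepSize α X * δ) with hC
    have hlim : Tendsto (fun θ : ℝ => ((k : ℝ) - 1) / (k + θ)) atTop (𝓝 0) :=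
      tendsto_const_nhds.div_atTop (tendsto_atTop_add_const_left _ _ tendsto_id)
    have hlimC := (hlim.norm.mul_const C)
    rw [norm_zero, zero_mul] at hlimC
    filter_upwards [ih (half_pos hε), hlimC.eventually (ge_mem_nhds (half_pos hε))]
      with θ hθ hβ y hy
    obtain ⟨h1, h2⟩ := hθ y hy
    set s := adgdState R α X y θ k with hs
    have hγ : 0 ≤ stepSize α X := by unfold stepSize; positivity
    have hu : ‖dualStep R α X y s.1 - dgdV R α X y (k + 1)‖ ≤ ε / 2 :=
      (hR.norm_dualStep_sub_le hw₀ hα X y _ _).trans h1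
    have hstep : ‖dualStep R α X y 0‖ ≤ ‖dualStep R α X y₀ 0‖ + stepSize α X * δ := by
      have h3 := norm_dualStep_sub_dualStep R hα.le X y y₀ 0
      have h4 := norm_le_norm_add_norm_sub' (dualStep R α X y 0) (dualStep R α X y₀ 0)
      have h5 := mul_le_mul_of_nonneg_left hy hγ
      linarith
    have hdiff : ‖dualStep R α X y s.1 - s.2‖ ≤ C := by
      have h3 := hR.norm_dgdV_succ_sub_le hw₀ hα X y k
      have h4 := norm_add₃_le (a := dualStep R α X y s.1 - dgdV R α X y (k + 1))
        (b := dgdV R α X y (k + 1) - dgdV R α X y k) (c := dgdV R α X y k - s.2)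
      rw [sub_add_sub_cancel, sub_add_sub_cancel, norm_sub_rev (dgdV R α X y k)] at h4
      linarith
    refine ⟨?_, hu.trans (half_le_self hε.le)⟩
    change ‖dualStep R α X y s.1 + (((k : ℝ) - 1) / (k + θ)) • (dualStep R α X y s.1 - s.2)
      - dgdV R α X y (k + 1)‖ ≤ ε
    rw [add_sub_right_comm]
    refine (norm_add_le _ _).trans ?_
    rw [norm_smul]
    have := mul_le_mul_of_nonneg_left hdiff (norm_nonneg (((k : ℝ) - 1) / (k + θ)))
    linarith

/-- Dual points close to a dual point satisfying the nondegenerate source condition have primal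
points in the manifold of partial smoothness. -/
theorem PartlySmooth.eventually_primalPoint_mem {R : E → EReal} (hR : Gamma0 R) {w : E}
    {M : Set E} (hM : PartlySmooth R w M) {α : ℝ} (hα : 0 < α) (X : E →L[ℝ] F) {v : F}
    (hv : -(X.adjoint v) ∈ intrinsicInterior ℝ (subdiff (regularized α R) w)) :
    ∀ᶠ v' in 𝓝 v, primalPoint R α X v' ∈ M := by
  have hw₀ := hM.subdiff_nonempty
  obtain ⟨ε, hε, hball⟩ := exists_ball_of_mem_intrinsicInterior hv
  have hmem := hR.sub_smul_mem_subdiff (intrinsicInterior_subset hv)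
  have hpv : primalPoint R α X v = w := hR.primalPoint_eq hα X hmem
  have hcont := hR.continuous_primalPoint hw₀ hα X
  have hid := hM.eventually_mem hR (ξ := -(X.adjoint v) - α • w) (half_pos hε) fun e he hle => by
    have := hR.sub_smul_mem_subdiff (hball e (hR.vectorSpan_regularized hα.le w he) (by linarith))
    rwa [sub_add_eq_add_sub]
  have hpt : Tendsto (primalPoint R α X) (𝓝 v) (𝓝 w) := hpv ▸ hcont.tendsto v
  have hsub : Continuous fun v' =>
      ‖-(X.adjoint v') - α • primalPoint R α X v' - (-(X.adjoint v) - α • w)‖ := by fun_prop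
  have hclose := (hsub.tendsto v).eventually_lt_const
    (by rw [hpv, sub_self, norm_zero]; positivity : _ < ε / 2 / 2)
  filter_upwards [hpt.eventually hid, hclose] with v' h1 h2
  exact h1 _ (hR.primalPoint_mem_subdiff hw₀ hα X v') h2

end Dual

theorem tendsto_stopTime {c : ℝ} (hc : 0 < c) :
    Tendsto (stopTime c) (𝓝[>] 0) atTop := by
  refine tendsto_nat_ceil_atTop.comp (Tendsto.const_mul_atTop hc ?_)
  exact tendsto_rpow_neg_nhdsGT_zero (by norm_num)

theorem tendsto_stopTime_mul {c : ℝ} (hc : 0 < c) :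
    Tendsto (fun δ => (stopTime c δ : ℝ) * δ) (𝓝[>] 0) (𝓝 0) := by
  have hupper : Tendsto (fun δ : ℝ => c * δ ^ (1 / 2 : ℝ) + δ) (𝓝[>] 0) (𝓝 0) := by
    have : ContinuousAt (fun δ : ℝ => c * δ ^ (1 / 2 : ℝ) + δ) 0 := by
      refine ((Real.continuousAt_rpow_const _ _ (Or.inr (by norm_num))).const_mul c).add
        continuousAt_id
    simpa using this.tendsto.mono_left nhdsWithin_le_nhds
  refine tendsto_of_tendsto_of_tendsto_of_le_of_le' tendsto_const_nhds hupper ?_ ?_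
  · filter_upwards [self_mem_nhdsWithin] with δ hδ
    exact mul_nonneg (Nat.cast_nonneg _) (le_of_lt hδ)
  · filter_upwards [self_mem_nhdsWithin] with δ hδ
    have hδ0 : (0 : ℝ) < δ := hδ
    have h1 : (stopTime c δ : ℝ) < c * δ ^ (-(1 / 2) : ℝ) + 1 :=
      Nat.ceil_lt_add_one (by positivity)
    have h2 : δ ^ (-(1 / 2) : ℝ) * δ = δ ^ (1 / 2 : ℝ) := by
      conv_lhs => rw [← Real.rpow_add_one hδ0.ne']
      norm_num
    calc (stopTime c δ : ℝ) * δ ≤ (c * δ ^ (-(1 / 2) : ℝ) + 1) * δ :=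
          mul_le_mul_of_nonneg_right h1.le hδ0.le
      _ = c * δ ^ (1 / 2 : ℝ) + δ := by rw [add_mul, mul_assoc, h2, one_mul]

end IterReg

theorem corollary4p3 {p n : ℕ}
    (R : EuclideanSpace ℝ (Fin p) → EReal) (hR : IterReg.Gamma0 R)
    (α : ℝ) (hα : 0 < α)
    (X : EuclideanSpace ℝ (Fin p) →L[ℝ] EuclideanSpace ℝ (Fin n)) (hX : X ≠ 0)
    (y₀ : EuclideanSpace ℝ (Fin n))
    (wd : EuclideanSpace ℝ (Fin p)) (vd : EuclideanSpace ℝ (Fin n))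
    (M : Set (EuclideanSpace ℝ (Fin p)))
    -- `wd` is the unique solution of the noiseless primal problem
    (hwd : IterReg.IsPrimalSolution R α X y₀ wd)
    (hwd_unique : ∀ w, IterReg.IsPrimalSolution R α X y₀ w → w = wd)
    -- the noiseless DGD dual iterates converge to the dual solution `vd`
    (hvd : IterReg.IsDualSolution R α X y₀ vd)
    (hconv : Tendsto (IterReg.dgdV R α X y₀) atTop (𝓝 vd))
    -- nondegenerate source condition
    (hsc : -(X.adjoint vd) ∈
      intrinsicInterior ℝ (IterReg.subdiff (IterReg.regularized α R) wd))
    (hM : IterReg.PartlySmooth R wd M)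
    (c : ℝ) (hc : 0 < c) :
    ∃ δ₀ : ℝ, 0 < δ₀ ∧ ∀ δ : ℝ, 0 < δ → δ < δ₀ →
      ∃ θδ : ℝ, ∀ θ : ℝ, 2 < θ → θδ < θ →
        ∀ y : EuclideanSpace ℝ (Fin n), ‖y - y₀‖ ≤ δ →
          IterReg.adgdW R α X y θ (IterReg.stopTime c δ) ∈ M ∧
          ∃ kl ku : ℕ, 0 < kl ∧ kl < IterReg.stopTime c δ ∧ IterReg.stopTime c δ < ku ∧
            ∀ k : ℕ, kl ≤ k → k ≤ ku → IterReg.adgdW R α X y θ k ∈ M := by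
  have hw₀ := hM.subdiff_nonempty
  obtain ⟨ε, hε, hball⟩ := Metric.eventually_nhds_iff.1
    (hM.eventually_primalPoint_mem hR hα X hsc)
  have hε3 : 0 < ε / 3 := by positivity
  obtain ⟨N, hN⟩ := Metric.tendsto_atTop.1 hconv (ε / 3) hε3
  have hsmall : Tendsto (fun δ : ℝ => (IterReg.stopTime c δ * δ + 2 * δ) * IterReg.stepSize α X)
      (𝓝[>] 0) (𝓝 0) := by
    have hid : Tendsto (fun δ : ℝ => 2 * δ) (𝓝[>] 0) (𝓝 (2 * 0)) :=
      (tendsto_id.mono_left nhdsWithin_le_nhds).const_mul 2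
    simpa using ((IterReg.tendsto_stopTime_mul hc).add hid).mul_const (IterReg.stepSize α X)
  have hev : ∀ᶠ δ in 𝓝[>] (0 : ℝ), N + 2 ≤ IterReg.stopTime c δ ∧
      (IterReg.stopTime c δ * δ + 2 * δ) * IterReg.stepSize α X < ε / 3 :=
    ((IterReg.tendsto_stopTime hc).eventually_ge_atTop _).and
      (hsmall.eventually (gt_mem_nhds hε3))
  obtain ⟨δ₀, hδ₀, hsub⟩ := mem_nhdsGT_iff_exists_Ioo_subset.1 hev
  refine ⟨δ₀, hδ₀, fun δ hδ hδlt => ?_⟩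
  obtain ⟨hKN, hKδ⟩ := hsub ⟨hδ, hδlt⟩
  set K := IterReg.stopTime c δ with hK
  obtain ⟨θδ, hθδ⟩ := eventually_atTop.1 ((eventually_all_finset (Finset.range (K + 3))).2
    fun k _ => hR.eventually_adgdState_close hw₀ hα X y₀ δ k hε3)
  refine ⟨θδ, fun θ _ hθ y hy => ?_⟩
  have hmem : ∀ k : ℕ, K - 1 ≤ k → k ≤ K + 1 → IterReg.adgdW R α X y θ k ∈ M := by
    intro k hk1 hk2
    refine hball ?_
    have h1 : ‖IterReg.adgdU R α X y θ k - IterReg.dgdV R α X y (k + 1)‖ ≤ ε / 3 :=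
      (hθδ θ hθ.le (k + 1) (Finset.mem_range.2 (by omega)) y hy).2
    have h2 := hR.norm_dgdV_sub_le hw₀ hα X y y₀ (k + 1)
    have h3 := hN (k + 1) (by omega)
    have hγ : 0 ≤ IterReg.stepSize α X := by unfold IterReg.stepSize; positivity
    have h4 : ((k + 1 : ℕ) : ℝ) * (IterReg.stepSize α X * ‖y - y₀‖) ≤
        (K * δ + 2 * δ) * IterReg.stepSize α X := by
      have hk : ((k + 1 : ℕ) : ℝ) ≤ K + 2 := by exact_mod_cast (by omega : k + 1 ≤ K + 2)
      calc ((k + 1 : ℕ) : ℝ) * (IterReg.stepSize α X * ‖y - y₀‖)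
          ≤ (K + 2) * (IterReg.stepSize α X * δ) := by gcongr
        _ = (K * δ + 2 * δ) * IterReg.stepSize α X := by ring
    rw [dist_eq_norm] at h3 ⊢
    have h5 := norm_add₃_le (a := IterReg.adgdU R α X y θ k - IterReg.dgdV R α X y (k + 1))
      (b := IterReg.dgdV R α X y (k + 1) - IterReg.dgdV R α X y₀ (k + 1))
      (c := IterReg.dgdV R α X y₀ (k + 1) - vd)
    rw [sub_add_sub_cancel, sub_add_sub_cancel] at h5
    linarith
  exact ⟨hmem K (by omega) (by omega), K - 1, K + 1, by omega, by omega, by omega, hmem⟩
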